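/- Let $\sigma:\mathbb{R}\to\mathbb{R}$ be an activation function for which there is a constant $c_\sigma\ge 1$ with the following property: for all $L\ge 0$, $R>0$, $\delta>0$ and every $L$-Lipschitz function $g:\mathbb{R}\to\mathbb{R}$ that is constant outside $[-R,R]$, there exist an integer $w$ with $0\le w\le c_\sigma RL/\delta$ and reals $a,\alpha_1,\dots,\alpha_w,\beta_1,\dots,\beta_w,\gamma_1,\dots,\gamma_w$ such that $$\sup_{x\in\mathbb{R}}\Big|g(x)-a-\sum_{i=1}^{w}\alpha_i\,\sigma(\beta_i x-\gamma_i)\Big|\le\delta .$$ Then there is a constant $C>0$, depending only on $\sigma$, such that the following holds for every integer $d\ge 1$ and every $\epsilon>0$. Let $B_d=\{\mathbf{x}\in\mathbb{R}^d:\|\mathbf{x}\|\le 1\}$ be the closed Euclidean unit ball, and let $f$ be a radial function $f(\mathbf{x})=\varphi(\|\mathbf{x}\|)$ that is $1$-Lipschitz on $B_d$. Then there is a depth-2 network with $\sigma$ activations and width $w$, an integer with $$0\le w\le\exp\!\big(C\,\epsilon^{-9}\log(d/\epsilon)\big),$$ that is, there are $v_i,b_i,b_0\in\mathbb{R}$ and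 $\mathbf{w}_i\in\mathbb{R}^d$ ($1\le i\le w$), such that $$\sup_{\mathbf{x}\in B_d}\Big|\sum_{i=1}^{w}v_i\,\sigma(\mathbf{w}_i^{\top}\mathbf{x}+b_i)+b_0-f(\mathbf{x})\Big|\le\epsilon .$$ In particular, for each fixed $\epsilon$ the width bound $(d/\epsilon)^{C\epsilon^{-9}}$ is polynomial in $d$. -/

import Mathlib

open scoped NNReal BigOperators

/-- The univariate approximation property of an activation `σ`: there is a constant `c ≥ 1` such
that every `L`-Lipschitz `f : ℝ → ℝ` that is constant outside `[-R, R]` is, for every `δ > 0`,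
uniformly `δ`-close on `ℝ` to some `x ↦ a + ∑ i, αᵢ σ (βᵢ x - γᵢ)` with at most `c R L / δ`
terms. -/
def UnivariateApproximator (σ : ℝ → ℝ) : Prop :=
  ∃ c : ℝ, 1 ≤ c ∧
    ∀ (L : ℝ≥0) (R δ : ℝ), 0 < R → 0 < δ →
      ∀ f : ℝ → ℝ, LipschitzWith L f →
        (∃ k : ℝ, ∀ x : ℝ, x ∉ Set.Icc (-R) R → f x = k) →
        ∃ (w : ℕ) (a : ℝ) (α β γ : Fin w → ℝ),
          (w : ℝ) ≤ c * (R * L / δ) ∧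
          ∀ x : ℝ, |f x - (a + ∑ i, α i * σ (β i * x - γ i))| ≤ δ

/-- The function computed by a depth 2 network on `ℝ^d` with activation `σ` and width `w`, hidden
weights `W i`, hidden biases `b i`, output weights `v i` and output bias `b₀`. -/
noncomputable def depthTwoNetwork (σ : ℝ → ℝ) {d w : ℕ} (v : Fin w → ℝ)
    (W : Fin w → EuclideanSpace ℝ (Fin d)) (b : Fin w → ℝ) (b₀ : ℝ)
    (x : EuclideanSpace ℝ (Fin d)) : ℝ :=
  ∑ i, v i * σ (inner ℝ (W i) x + b i) + b₀

/-! Write `f x = φ 0 + h (‖x‖ ^ 2)` with `h s = φ √s - φ 0`, which satisfies `|h s - h t| ≤ √|s -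
t|` on `[0, 1]`. Replace `‖x‖ ^ 2` by `q x = ∑ 2 (1 - cos (t xᵢ)) / t ^ 2` (`trigNormSq`), a
combination of `d + 1` plane waves with error at most `t ^ 2` on the ball, whatever `d` is. Replace
`h` by its Bernstein polynomial of degree `n` of order `ε⁻⁴` (`abs_bernstein_sub_le`).

A product of cosines is a sum of cosines, so the polynomial in `q` is again a sum of plane waves: at
most `M = (16 B) ^ n` of them, with coefficient mass at most `M` and frequencies at most `n`, where
`B = 64 d / ε ^ 2` (`IsCosineSum.bernstein_comp`). On the ball each wave is a univariate function on
`[-n, n]`, so the hypothesis on `σ` replaces it by neurons with error `ε / (4 M)`. The resulting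
width is `(d / ε) ^ O(n)`. -/

/-- `g` is a finite sum of plane waves `c * cos (⟪w, x⟫ + b)` with at most `M` terms, coefficients
of total absolute value at most `M`, and frequencies of norm at most `Λ`. -/
def IsCosineSum {E : Type*} [NormedAddCommGroup E] [InnerProductSpace ℝ E] (M Λ : ℝ)
    (g : E → ℝ) : Prop :=
  ∃ (ι : Type) (_ : Fintype ι) (c b : ι → ℝ) (W : ι → E),
    (Fintype.card ι : ℝ) ≤ M ∧ ∑ i, |c i| ≤ M ∧ (∀ i, ‖W i‖ ≤ Λ) ∧
      ∀ x, g x = ∑ i, c i * Real.cos (inner ℝ (W i) x + b i)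

/-! ### Algebra of cosine sums -/

namespace IsCosineSum

variable {E : Type*} [NormedAddCommGroup E] [InnerProductSpace ℝ E] {M M₁ M₂ Λ Λ₁ Λ₂ : ℝ}
  {g g₁ g₂ : E → ℝ}

theorem mono (h : IsCosineSum M₁ Λ₁ g) (hM : M₁ ≤ M₂) (hΛ : Λ₁ ≤ Λ₂) : IsCosineSum M₂ Λ₂ g := by
  obtain ⟨ι, hι, c, b, W, h1, h2, h3, h4⟩ := h
  exact ⟨ι, hι, c, b, W, h1.trans hM, h2.trans hM, fun i => (h3 i).trans hΛ, h4⟩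

theorem nonneg (h : IsCosineSum M Λ g) : 0 ≤ M := by
  obtain ⟨ι, hι, c, b, W, h1, -⟩ := h
  exact (Nat.cast_nonneg _).trans h1

theorem const (a : ℝ) (hM : 1 ≤ M) (ha : |a| ≤ M) (hΛ : 0 ≤ Λ) :
    IsCosineSum M Λ (fun _ : E => a) :=
  ⟨Unit, inferInstance, fun _ => a, fun _ => 0, fun _ => 0, by simpa using hM, by simpa using ha,
    by simpa using hΛ, by simp⟩

theorem const_mul (h : IsCosineSum M Λ g) {a r : ℝ} (ha : |a| ≤ r) (hr : 1 ≤ r) :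
    IsCosineSum (r * M) Λ (fun x => a * g x) := by
  have hM := h.nonneg
  obtain ⟨ι, hι, c, b, W, h1, h2, h3, h4⟩ := h
  refine ⟨ι, hι, fun i => a * c i, b, W, h1.trans (le_mul_of_one_le_left hM hr), ?_, h3, ?_⟩
  · simp only [abs_mul, ← Finset.mul_sum]
    exact mul_le_mul ha h2 (by positivity) (by linarith)
  · intro x
    simp only [h4, Finset.mul_sum, mul_assoc]

theorem sum {κ : Type} [Fintype κ] {G : κ → E → ℝ} (h : ∀ k, IsCosineSum M Λ (G k)) :
    IsCosineSum (Fintype.card κ * M) Λ (fun x => ∑ k, G k x) := by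
  choose ι hι c b W h1 h2 h3 h4 using h
  refine ⟨Σ k, ι k, inferInstance, fun p => c p.1 p.2, fun p => b p.1 p.2, fun p => W p.1 p.2,
    ?_, ?_, fun p => h3 _ _, ?_⟩
  · rw [Fintype.card_sigma]
    push_cast
    calc _ ≤ ∑ _k : κ, M := Finset.sum_le_sum fun k _ => h1 k
      _ = _ := by simp
  · rw [Fintype.sum_sigma]
    calc _ ≤ ∑ _k : κ, M := Finset.sum_le_sum fun k _ => h2 k
      _ = _ := by simp
  · intro x
    simp only [h4, Fintype.sum_sigma]

/-- Product-to-sum: `2 cos u cos v = cos (u + v) + cos (u - v)`. Hence two copies of the product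
index, and frequencies that only add. -/
theorem mul (h₁ : IsCosineSum M₁ Λ₁ g₁) (h₂ : IsCosineSum M₂ Λ₂ g₂) :
    IsCosineSum (2 * M₁ * M₂) (Λ₁ + Λ₂) (fun x => g₁ x * g₂ x) := by
  have hM₁ := h₁.nonneg
  have hM₂ := h₂.nonneg
  obtain ⟨ι₁, hι₁, c₁, b₁, W₁, p1, p2, p3, p4⟩ := h₁
  obtain ⟨ι₂, hι₂, c₂, b₂, W₂, q1, q2, q3, q4⟩ := h₂
  refine ⟨(ι₁ × ι₂) ⊕ (ι₁ × ι₂), inferInstance,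
    Sum.elim (fun p => c₁ p.1 * c₂ p.2 / 2) (fun p => c₁ p.1 * c₂ p.2 / 2),
    Sum.elim (fun p => b₁ p.1 + b₂ p.2) (fun p => b₁ p.1 - b₂ p.2),
    Sum.elim (fun p => W₁ p.1 + W₂ p.2) (fun p => W₁ p.1 - W₂ p.2), ?_, ?_, ?_, ?_⟩
  · simp only [Fintype.card_sum, Fintype.card_prod]
    push_cast
    have := mul_le_mul p1 q1 (Nat.cast_nonneg _) hM₁
    linarith
  · have h0 : ∑ p : ι₁ × ι₂, |c₁ p.1 * c₂ p.2 / 2| = (∑ i, |c₁ i|) * (∑ j, |c₂ j|) / 2 := by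
      rw [Finset.sum_mul_sum, Fintype.sum_prod_type, Finset.sum_div]
      refine Finset.sum_congr rfl fun i _ => ?_
      rw [Finset.sum_div]
      refine Finset.sum_congr rfl fun j _ => ?_
      rw [abs_div, abs_mul, abs_two]
    simp only [Fintype.sum_sum_type, Sum.elim_inl, Sum.elim_inr, h0]
    have := mul_le_mul p2 q2 (Finset.sum_nonneg fun _ _ => abs_nonneg _) hM₁
    have := mul_nonneg hM₁ hM₂
    linarith
  · rintro (p | p)
    · exact (norm_add_le _ _).trans (add_le_add (p3 _) (q3 _))
    · exact (norm_sub_le _ _).trans (add_le_add (p3 _) (q3 _))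
  · intro x
    simp only [Fintype.sum_sum_type, Sum.elim_inl, Sum.elim_inr, p4, q4, Finset.sum_mul_sum,
      Fintype.sum_prod_type, ← Finset.sum_add_distrib]
    refine Finset.sum_congr rfl fun i _ => Finset.sum_congr rfl fun j _ => ?_
    have hadd := Real.cos_add (inner ℝ (W₁ i) x + b₁ i) (inner ℝ (W₂ j) x + b₂ j)
    have hsub := Real.cos_sub (inner ℝ (W₁ i) x + b₁ i) (inner ℝ (W₂ j) x + b₂ j)
    rw [add_add_add_comm] at hadd
    rw [add_sub_add_comm] at hsub
    rw [inner_add_left, inner_sub_left, hadd, hsub]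
    ring

theorem pow (h : IsCosineSum M Λ g) (k : ℕ) :
    IsCosineSum ((2 * M) ^ k) (k * Λ) (fun x => g x ^ k) := by
  induction k with
  | zero => simpa using const (E := E) (M := 1) (Λ := 0) 1 le_rfl (by simp) le_rfl
  | succ k ih =>
    have := ih.mul h
    simp only [pow_succ]
    refine this.mono (le_of_eq (by ring)) (le_of_eq (by push_cast; ring))

/-- Bernstein polynomials of a function with values in `[-1, 1]`, composed with a cosine sum. -/
theorem bernstein_comp {q : E → ℝ} {B : ℝ} (hB : 1 ≤ B) (hq : IsCosineSum B Λ q)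
    (hq' : IsCosineSum B Λ (fun x => 1 - q x)) (n : ℕ) (a : Fin (n + 1) → ℝ)
    (ha : ∀ k, |a k| ≤ 1) :
    IsCosineSum ((16 * B) ^ n) (n * Λ)
      (fun x => ∑ k : Fin (n + 1), a k * (n.choose k * q x ^ (k : ℕ) * (1 - q x) ^ (n - k))) := by
  have hterm : ∀ k : Fin (n + 1), IsCosineSum ((8 * B) ^ n) (n * Λ)
      (fun x => a k * (n.choose k * q x ^ (k : ℕ) * (1 - q x) ^ (n - k))) := by
    intro k
    have hk : (k : ℕ) ≤ n := k.is_le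
    have h2 : (1 : ℝ) ≤ 2 ^ n := one_le_pow₀ (by norm_num)
    have hc : |a k * n.choose k| ≤ 2 ^ n := by
      rw [abs_mul, Nat.abs_cast]
      have : ((n.choose k : ℕ) : ℝ) ≤ 2 ^ n := by exact_mod_cast Nat.choose_le_two_pow n k
      calc |a k| * (n.choose k : ℝ) ≤ 1 * 2 ^ n :=
            mul_le_mul (ha k) this (Nat.cast_nonneg _) zero_le_one
        _ = _ := one_mul _
    have := (((hq.pow k).mul (hq'.pow (n - k))).const_mul hc h2)
    simp only [mul_assoc] at this ⊢
    -- The spare factor 2 from `mul` is absorbed by `2 ^ n` only when `n > 0`.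
    rcases Nat.eq_zero_or_pos n with rfl | hn
    · have hk0 : (k : ℕ) = 0 := by omega
      simp only [hk0]
      simpa using const (E := E) (M := 1) (Λ := 0) (a k) le_rfl (ha k) le_rfl
    · refine this.mono ?_ (le_of_eq ?_)
      · calc (2 : ℝ) ^ n * (2 * ((2 * B) ^ (k : ℕ) * (2 * B) ^ (n - k)))
            = 2 * (4 * B) ^ n := by
              rw [← pow_add, Nat.add_sub_cancel' hk, show (4 : ℝ) * B = 2 * (2 * B) by ring,
                mul_pow 2 (2 * B)]
              ring
          _ ≤ 2 ^ n * (4 * B) ^ n := by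
              gcongr
              exact le_self_pow₀ (by norm_num) hn.ne'
          _ = _ := by rw [← mul_pow]; ring
      · rw [Nat.cast_sub hk]; ring
  refine (sum hterm).mono ?_ le_rfl
  have : ((n + 1 : ℕ) : ℝ) ≤ 2 ^ n := by exact_mod_cast Nat.lt_two_pow_self
  rw [Fintype.card_fin]
  calc _ ≤ 2 ^ n * (8 * B) ^ n := by gcongr
    _ = _ := by rw [← mul_pow]; ring

end IsCosineSum

/-! ### From plane waves to neurons -/

/-- A plane wave restricted to `[-nπ, nπ]` is approximated by few neurons. -/
theorem exists_univariate_approx_cos {σ : ℝ → ℝ} {c : ℝ}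
    (hc : ∀ (L : ℝ≥0) (R δ : ℝ), 0 < R → 0 < δ →
      ∀ f : ℝ → ℝ, LipschitzWith L f →
        (∃ k : ℝ, ∀ x : ℝ, x ∉ Set.Icc (-R) R → f x = k) →
        ∃ (w : ℕ) (a : ℝ) (α β γ : Fin w → ℝ),
          (w : ℝ) ≤ c * (R * L / δ) ∧
          ∀ x : ℝ, |f x - (a + ∑ i, α i * σ (β i * x - γ i))| ≤ δ)
    {n : ℕ} (hn : n ≠ 0) (b : ℝ) {δ : ℝ} (hδ : 0 < δ) :
    ∃ (w : ℕ) (a : ℝ) (α β γ : Fin w → ℝ),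
      (w : ℝ) ≤ c * (n * Real.pi / δ) ∧
      ∀ y : ℝ, |y| ≤ n → |Real.cos (y + b) - (a + ∑ i, α i * σ (β i * y - γ i))| ≤ δ := by
  have hn' : (0 : ℝ) < n := by exact_mod_cast Nat.pos_of_ne_zero hn
  -- The clamping points `-R` and `R` differ by `n` full periods, so the clamped wave has the same
  -- constant value on both sides.
  set R : ℝ := n * Real.pi with hR
  have hRpos : 0 < R := by positivity
  have hlip : LipschitzWith 1 (fun y : ℝ => Real.cos (max (-R) (min y R) + b)) := by
    have h1 : LipschitzWith 1 (fun y : ℝ => max (-R) (min y R) + b) := by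
      have := ((LipschitzWith.id (α := ℝ)).min_const R).const_max (-R)
      simpa using this.add (LipschitzWith.const b)
    simpa [Function.comp_def] using Real.lipschitzWith_cos.comp h1
  obtain ⟨w, a, α, β, γ, hw, happ⟩ := hc 1 R δ hRpos hδ _ hlip ⟨Real.cos (R + b), by
    intro x hx
    by_cases h : x < -R
    · rw [min_eq_left (by linarith), max_eq_left h.le, ← Real.cos_add_nat_mul_two_pi (-R + b) n]
      congr 1
      rw [hR]; ring
    · have : R < x := by
        by_contra h'
        exact hx ⟨not_lt.1 h, not_lt.1 h'⟩
      rw [min_eq_right this.le, max_eq_right (by linarith)]⟩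
  refine ⟨w, a, α, β, γ, by simpa using hw, fun y hy => ?_⟩
  have hnR : (n : ℝ) ≤ R := le_mul_of_one_le_right hn'.le (by linarith [Real.pi_gt_three])
  have hy' := abs_le.1 hy
  have := happ y
  rwa [min_eq_left (by linarith), max_eq_right (by linarith)] at this

/-- A cosine sum is approximated on the unit ball by a depth 2 network. -/
theorem IsCosineSum.exists_network {σ : ℝ → ℝ} {c : ℝ} (hc1 : 0 ≤ c)
    (hc : ∀ (L : ℝ≥0) (R δ : ℝ), 0 < R → 0 < δ →
      ∀ f : ℝ → ℝ, LipschitzWith L f →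
        (∃ k : ℝ, ∀ x : ℝ, x ∉ Set.Icc (-R) R → f x = k) →
        ∃ (w : ℕ) (a : ℝ) (α β γ : Fin w → ℝ),
          (w : ℝ) ≤ c * (R * L / δ) ∧
          ∀ x : ℝ, |f x - (a + ∑ i, α i * σ (β i * x - γ i))| ≤ δ)
    {d n : ℕ} (hn : n ≠ 0) {M : ℝ} {g : EuclideanSpace ℝ (Fin d) → ℝ}
    (hg : IsCosineSum M n g) {δ : ℝ} (hδ : 0 < δ) :
    ∃ (w : ℕ) (v : Fin w → ℝ) (W : Fin w → EuclideanSpace ℝ (Fin d)) (b : Fin w → ℝ) (b₀ : ℝ),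
      (w : ℝ) ≤ M * (c * (n * Real.pi / δ)) ∧
      ∀ x ∈ Metric.closedBall (0 : EuclideanSpace ℝ (Fin d)) 1,
        |depthTwoNetwork σ v W b b₀ x - g x| ≤ M * δ := by
  obtain ⟨ι, hι, c', b, W, h1, h2, h3, h4⟩ := hg
  choose w a α β γ hw happ using fun i => exists_univariate_approx_cos hc hn (b i) hδ
  let e := Fintype.equivFin (Σ i, Fin (w i))
  refine ⟨Fintype.card (Σ i, Fin (w i)), fun j => c' (e.symm j).1 * α _ (e.symm j).2,
    fun j => β _ (e.symm j).2 • W (e.symm j).1, fun j => -γ _ (e.symm j).2, ∑ i, c' i * a i,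
    ?_, ?_⟩
  · rw [Fintype.card_sigma]
    simp only [Fintype.card_fin]
    push_cast
    calc ∑ i, (w i : ℝ) ≤ ∑ _i : ι, c * (n * Real.pi / δ) := Finset.sum_le_sum fun i _ => hw i
      _ = Fintype.card ι * (c * (n * Real.pi / δ)) := by simp
      _ ≤ _ := mul_le_mul_of_nonneg_right h1 (by positivity)
  · intro x hx
    have hx' : ‖x‖ ≤ 1 := by simpa using hx
    have hsum : ∀ F : (Σ i, Fin (w i)) → ℝ, ∑ j, F (e.symm j) = ∑ i, ∑ l, F ⟨i, l⟩ := by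
      intro F
      rw [Equiv.sum_comp e.symm F, Fintype.sum_sigma]
    have key : depthTwoNetwork σ (fun j => c' (e.symm j).1 * α _ (e.symm j).2)
        (fun j => β _ (e.symm j).2 • W (e.symm j).1) (fun j => -γ _ (e.symm j).2)
        (∑ i, c' i * a i) x - g x
        = ∑ i, c' i * -(Real.cos (inner ℝ (W i) x + b i)
          - (a i + ∑ l, α i l * σ (β i l * inner ℝ (W i) x - γ i l))) := by
      unfold depthTwoNetwork
      rw [hsum (fun p => c' p.1 * α _ p.2 * σ (inner ℝ (β _ p.2 • W p.1) x + -γ _ p.2)), h4,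
        ← Finset.sum_add_distrib, ← Finset.sum_sub_distrib]
      refine Finset.sum_congr rfl fun i _ => ?_
      simp only [inner_smul_left, RCLike.conj_to_real, ← sub_eq_add_neg, mul_assoc,
        ← Finset.mul_sum]
      ring
    rw [key]
    calc _ ≤ ∑ i, |c' i * -(Real.cos (inner ℝ (W i) x + b i)
          - (a i + ∑ l, α i l * σ (β i l * inner ℝ (W i) x - γ i l)))| :=
          Finset.abs_sum_le_sum_abs _ _
      _ ≤ ∑ i, |c' i| * δ := by
          refine Finset.sum_le_sum fun i _ => ?_
          rw [abs_mul, abs_neg]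
          -- Frequencies of norm at most `n` keep the argument in `[-n, n]` on the unit ball.
          refine mul_le_mul_of_nonneg_left (happ i _ ?_) (abs_nonneg _)
          calc |inner ℝ (W i) x| ≤ ‖W i‖ * ‖x‖ := abs_real_inner_le_norm _ _
            _ ≤ n * 1 := mul_le_mul (h3 i) hx' (norm_nonneg _) (Nat.cast_nonneg _)
            _ = n := mul_one _
      _ ≤ M * δ := by
          rw [← Finset.sum_mul]
          exact mul_le_mul_of_nonneg_right h2 hδ.le

/-! ### Bernstein approximation under a square-root modulus -/

/-- The Bernstein polynomial of degree `n` of a function `h` satisfying `|h s - h t| ≤ √|s - t|`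
on `[0, 1]` is `η + 1 / (4 n η ^ 3)`-close to `h`. -/
theorem abs_bernstein_sub_le {h : ℝ → ℝ}
    (hh : ∀ s ∈ Set.Icc (0 : ℝ) 1, ∀ t ∈ Set.Icc (0 : ℝ) 1, |h s - h t| ≤ √|s - t|)
    {n : ℕ} (hn : n ≠ 0) {η : ℝ} (hη : 0 < η) {s : ℝ} (hs : s ∈ Set.Icc (0 : ℝ) 1) :
    |∑ k : Fin (n + 1), h (k / n) * (n.choose k * s ^ (k : ℕ) * (1 - s) ^ (n - k)) - h s|
      ≤ η + 1 / (4 * n * η ^ 3) := by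
  have hn' : (0 : ℝ) < n := by exact_mod_cast Nat.pos_of_ne_zero hn
  let x : unitInterval := ⟨s, hs⟩
  have hprob := bernstein.probability n x
  have hvar := bernstein.variance hn x
  -- Trades the square-root modulus for a quadratic term, whose Bernstein average is the variance:
  -- if `r = √u > η`, then `r ≤ r ^ 4 / η ^ 3`.
  have hsqrt : ∀ u : ℝ, 0 ≤ u → √u ≤ η + u ^ 2 / η ^ 3 := by
    intro u hu
    set r := √u with hr
    have hr0 : 0 ≤ r := Real.sqrt_nonneg u
    have hu' : u = r ^ 2 := (Real.sq_sqrt hu).symm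
    rw [hu']
    rcases le_total r η with h1 | h1
    · have : 0 ≤ (r ^ 2) ^ 2 / η ^ 3 := by positivity
      linarith
    · have : r ≤ (r ^ 2) ^ 2 / η ^ 3 := by
        rw [le_div_iff₀ (by positivity)]
        calc r * η ^ 3 ≤ r * r ^ 3 := by gcongr
          _ = _ := by ring
      linarith
  have heq : ∑ k : Fin (n + 1), h (k / n) * (n.choose k * s ^ (k : ℕ) * (1 - s) ^ (n - k)) - h s
      = ∑ k : Fin (n + 1), (h (k / n) - h s) * bernstein n k x := by
    simp only [sub_mul, Finset.sum_sub_distrib, ← Finset.mul_sum, hprob, mul_one]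
    simp only [bernstein_apply, x]
  rw [heq]
  calc _ ≤ ∑ k : Fin (n + 1), |(h (k / n) - h s) * bernstein n k x| :=
        Finset.abs_sum_le_sum_abs _ _
    _ ≤ ∑ k : Fin (n + 1), (η * bernstein n k x
          + (x - bernstein.z k : ℝ) ^ 2 * bernstein n k x / η ^ 3) := by
        refine Finset.sum_le_sum fun k _ => ?_
        have hb : 0 ≤ bernstein n k x := bernstein_nonneg
        rw [abs_mul, abs_of_nonneg hb]
        have h1 : |h (k / n) - h s| ≤ η + (x - bernstein.z k : ℝ) ^ 2 / η ^ 3 := by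
          refine (hh _ (bernstein.z k).2 _ hs).trans ((hsqrt _ (abs_nonneg _)).trans (le_of_eq ?_))
          rw [sq_abs, ← neg_sub, neg_sq]
        calc _ ≤ (η + (x - bernstein.z k : ℝ) ^ 2 / η ^ 3) * bernstein n k x := by gcongr
          _ = _ := by ring
    _ = η + s * (1 - s) / n / η ^ 3 := by
        rw [Finset.sum_add_distrib, ← Finset.mul_sum, ← Finset.sum_div, hprob, hvar, mul_one]
    _ ≤ η + 1 / (4 * n * η ^ 3) := by
        have : s * (1 - s) ≤ 1 / 4 := by nlinarith [sq_nonneg (s - 1 / 2)]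
        have h2 : s * (1 - s) / n / η ^ 3 ≤ 1 / 4 / n / η ^ 3 := by gcongr
        have h3 : 1 / 4 / (n : ℝ) / η ^ 3 = 1 / (4 * n * η ^ 3) := by
          field_simp
        linarith

/-! ### Trigonometric surrogate for the squared norm -/

/-- A trigonometric approximation of `‖x‖ ^ 2` at scale `t`. -/
noncomputable def trigNormSq {d : ℕ} (t : ℝ) (x : EuclideanSpace ℝ (Fin d)) : ℝ :=
  ∑ i, 2 * (1 - Real.cos (t * x i)) / t ^ 2

theorem trigNormSq_nonneg {d : ℕ} (t : ℝ) (x : EuclideanSpace ℝ (Fin d)) :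
    0 ≤ trigNormSq t x :=
  Finset.sum_nonneg fun i _ => div_nonneg (by linarith [Real.cos_le_one (t * x i)]) (sq_nonneg t)

/-- Keeps the surrogate in `[0, 1]` on the unit ball, where the Bernstein estimate applies. -/
theorem trigNormSq_le {d : ℕ} {t : ℝ} (ht : 0 < t) (x : EuclideanSpace ℝ (Fin d)) :
    trigNormSq t x ≤ ‖x‖ ^ 2 := by
  rw [EuclideanSpace.real_norm_sq_eq]
  refine Finset.sum_le_sum fun i _ => ?_
  rw [div_le_iff₀ (by positivity)]
  have := Real.one_sub_sq_div_two_le_cos (x := t * x i)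
  linarith [mul_pow t (x i) 2]

/-- Coordinate `i` contributes at most `t ^ 2 * x i ^ 4 ≤ t ^ 2 * x i ^ 2`; the remaining square
sums to at most 1, so no factor `d` appears. -/
theorem norm_sq_sub_trigNormSq_le {d : ℕ} {t : ℝ} (ht : 0 < t) (ht1 : t ≤ 1)
    {x : EuclideanSpace ℝ (Fin d)} (hx : ‖x‖ ≤ 1) : ‖x‖ ^ 2 - trigNormSq t x ≤ t ^ 2 := by
  have hn : ∑ i, x i ^ 2 ≤ 1 := by
    rw [← EuclideanSpace.real_norm_sq_eq]
    exact pow_le_one₀ (norm_nonneg _) hx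
  rw [EuclideanSpace.real_norm_sq_eq, trigNormSq, ← Finset.sum_sub_distrib]
  calc _ ≤ ∑ i, t ^ 2 * x i ^ 2 := by
        refine Finset.sum_le_sum fun i _ => ?_
        have hi : x i ^ 2 ≤ 1 :=
          (Finset.single_le_sum (f := fun j => x j ^ 2) (fun j _ => sq_nonneg _)
            (Finset.mem_univ i)).trans hn
        have hi' : |x i| ≤ 1 := abs_le_one_iff_mul_self_le_one.2 (by nlinarith)
        have hti : |t * x i| ≤ 1 := by
          rw [abs_mul, abs_of_pos ht]
          exact mul_le_one₀ ht1 (abs_nonneg _) hi'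
        have h1 := (abs_le.1 (Real.cos_bound hti)).2
        have h4 : |t * x i| ^ 4 = t ^ 4 * (x i ^ 2 * x i ^ 2) := by
          rw [(by norm_num : 4 = 2 * 2), pow_mul, sq_abs]; ring
        have h5 : t ^ 4 * (x i ^ 2 * x i ^ 2) ≤ t ^ 4 * x i ^ 2 := by
          gcongr
          exact mul_le_of_le_one_left (sq_nonneg _) hi
        have h6 : 0 ≤ t ^ 4 * x i ^ 2 := by positivity
        rw [sub_le_iff_le_add, ← sub_le_iff_le_add', le_div_iff₀ (by positivity)]
        have h7 : (x i ^ 2 - t ^ 2 * x i ^ 2) * t ^ 2 = (t * x i) ^ 2 - t ^ 4 * x i ^ 2 := by ring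
        rw [h7]
        rw [h4] at h1
        linarith
    _ ≤ t ^ 2 := by
        rw [← Finset.mul_sum]
        exact mul_le_of_le_one_right (sq_nonneg t) hn

/-- `a + r * trigNormSq` is a cosine sum. -/
theorem isCosineSum_const_add_trigNormSq {d : ℕ} (hd : 1 ≤ d) {t : ℝ} (ht : 0 < t) (ht1 : t ≤ 1)
    (a r : ℝ) (hr : |r| ≤ 1) (har : |a + r * (2 * d / t ^ 2)| ≤ 2 * d / t ^ 2) :
    IsCosineSum (4 * d / t ^ 2) 1
      (fun x : EuclideanSpace ℝ (Fin d) => a + r * trigNormSq t x) := by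
  have ht2 : t ^ 2 ≤ 1 := pow_le_one₀ ht.le ht1
  have hd' : (1 : ℝ) ≤ d := by exact_mod_cast hd
  -- `none` is the zero frequency and carries the constant term.
  refine ⟨Option (Fin d), inferInstance,
    fun o => o.elim (a + r * (2 * d / t ^ 2)) (fun _ => -r * (2 / t ^ 2)), fun _ => 0,
    fun o => o.elim 0 (fun i => t • EuclideanSpace.single i 1), ?_, ?_, ?_, ?_⟩
  · rw [Fintype.card_option, Fintype.card_fin, le_div_iff₀ (by positivity)]
    push_cast
    nlinarith
  · simp only [Fintype.sum_option, Option.elim_none, Option.elim_some, Finset.sum_const,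
      Finset.card_univ, Fintype.card_fin, nsmul_eq_mul, abs_mul, abs_neg]
    rw [abs_of_pos (show 0 < 2 / t ^ 2 by positivity)]
    have h1 : (d : ℝ) * (|r| * (2 / t ^ 2)) ≤ d * (1 * (2 / t ^ 2)) := by gcongr
    have h2 : (d : ℝ) * (1 * (2 / t ^ 2)) = 2 * d / t ^ 2 := by ring
    have h3 : 4 * (d : ℝ) / t ^ 2 = 2 * d / t ^ 2 + 2 * d / t ^ 2 := by ring
    linarith
  · rintro (_ | i)
    · simp
    · simpa [norm_smul, abs_of_pos ht] using ht1
  · intro x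
    simp only [Fintype.sum_option, Option.elim_none, Option.elim_some, inner_zero_left, add_zero,
      Real.cos_zero, mul_one, inner_smul_left, RCLike.conj_to_real, EuclideanSpace.inner_single_left,
      map_one, one_mul, trigNormSq, ← Finset.mul_sum, ← Finset.sum_div, mul_sub,
      Finset.sum_sub_distrib, Finset.sum_const, Finset.card_univ, Fintype.card_fin, nsmul_eq_mul]
    ring

theorem abs_sqrt_sub_sqrt_le (a b : ℝ) (ha : 0 ≤ a) (hb : 0 ≤ b) : |√a - √b| ≤ √|a - b| := by
  refine Real.le_sqrt_of_sq_le ?_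
  -- Difference of squares; then `|√a - √b| ≤ √a + √b`.
  have h : |a - b| = |√a - √b| * |√a + √b| := by
    rw [← abs_mul]
    congr 1
    nlinarith [Real.sq_sqrt ha, Real.sq_sqrt hb]
  rw [h, sq]
  refine mul_le_mul_of_nonneg_left ?_ (abs_nonneg _)
  have := Real.sqrt_nonneg a
  have := Real.sqrt_nonneg b
  rw [abs_of_nonneg (by positivity : 0 ≤ √a + √b), abs_le]
  constructor <;> linarith

/-- The profile of a `1`-Lipschitz radial function is `1`-Lipschitz. -/
theorem abs_profile_sub_le {d : ℕ} (hd : 1 ≤ d) {f : EuclideanSpace ℝ (Fin d) → ℝ} {φ : ℝ → ℝ}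
    (hf : ∀ x ∈ Metric.closedBall (0 : EuclideanSpace ℝ (Fin d)) 1, f x = φ ‖x‖)
    (hlip : LipschitzOnWith 1 f (Metric.closedBall (0 : EuclideanSpace ℝ (Fin d)) 1))
    {r s : ℝ} (hr : r ∈ Set.Icc (0 : ℝ) 1) (hs : s ∈ Set.Icc (0 : ℝ) 1) :
    |φ r - φ s| ≤ |r - s| := by
  -- Restricting `f` to a ray recovers `φ`; a unit vector exists since `d ≥ 1`.
  let e : EuclideanSpace ℝ (Fin d) := EuclideanSpace.single ⟨0, hd⟩ 1
  have he : ‖e‖ = 1 := by simp [e]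
  have hnorm : ∀ u : ℝ, u ∈ Set.Icc (0 : ℝ) 1 → ‖u • e‖ = u := fun u hu => by
    rw [norm_smul, he, mul_one, Real.norm_of_nonneg hu.1]
  have hmem : ∀ u : ℝ, u ∈ Set.Icc (0 : ℝ) 1 →
      u • e ∈ Metric.closedBall (0 : EuclideanSpace ℝ (Fin d)) 1 := fun u hu => by
    rw [mem_closedBall_zero_iff, hnorm u hu]
    exact hu.2
  have := hlip.dist_le_mul _ (hmem r hr) _ (hmem s hs)
  rw [hf _ (hmem r hr), hf _ (hmem s hs), hnorm r hr, hnorm s hs, Real.dist_eq, dist_eq_norm,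
    ← sub_smul, norm_smul, he] at this
  simpa using this

/-! ### Width count and assembly -/

/-- Numerical bound for the width. -/
theorem width_bound {c d ε : ℝ} {m n : ℕ} (hm : 16 * c ≤ 2 ^ m) (hc : 0 ≤ c) (hd : 1 ≤ d)
    (hε : 0 < ε) (hε2 : ε < 1 / 2) (hn : n ≠ 0) (hn2 : (n : ℝ) ≤ 128 / ε ^ 4) :
    (16 * (64 * d / ε ^ 2)) ^ n *
        (c * (n * Real.pi / (ε / (4 * (16 * (64 * d / ε ^ 2)) ^ n))))
      ≤ Real.exp (128 * (26 + m) * (ε ^ (-9 : ℤ) * Real.log (d / ε))) := by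
  set X : ℝ := d / ε with hX
  have hεX : 1 / ε ≤ X := by rw [hX]; gcongr
  -- With `X ≥ 2`, every numerical constant is absorbed into a power of `X`.
  have hX2 : 2 ≤ X := by
    refine le_trans ?_ hεX
    rw [le_div_iff₀ hε]; linarith
  have hX1 : 1 ≤ X := by linarith
  have hX0 : 0 < X := by linarith
  have hB : 16 * (64 * d / ε ^ 2) ≤ X ^ 12 := by
    calc 16 * (64 * d / ε ^ 2) = 2 ^ 10 * (X * (1 / ε)) := by rw [hX]; field_simp; norm_num
      _ ≤ X ^ 10 * (X * X) := by gcongr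
      _ = X ^ 12 := by ring
  have hB0 : 0 < 16 * (64 * d / ε ^ 2) := by positivity
  set B : ℝ := 16 * (64 * d / ε ^ 2) with hBdef
  have h1 : B ^ n * (c * (n * Real.pi / (ε / (4 * B ^ n))))
      = 4 * Real.pi * c * n * (1 / ε) * (B ^ n) ^ 2 := by
    field_simp
  have h2 : 4 * Real.pi * c ≤ X ^ m := by
    calc 4 * Real.pi * c ≤ 16 * c := by
          have := Real.pi_le_four
          gcongr; linarith
      _ ≤ 2 ^ m := hm
      _ ≤ X ^ m := by gcongr
  have h3 : (n : ℝ) ≤ X ^ n := by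
    calc (n : ℝ) ≤ 2 ^ n := by exact_mod_cast Nat.lt_two_pow_self.le
      _ ≤ X ^ n := by gcongr
  have h4 : B ^ n * (c * (n * Real.pi / (ε / (4 * B ^ n)))) ≤ X ^ ((26 + m) * n) := by
    rw [h1]
    calc _ ≤ X ^ m * X ^ n * X * ((X ^ 12) ^ n) ^ 2 := by gcongr
      _ = X ^ (m + 1 + 25 * n) := by ring
      _ ≤ X ^ ((26 + m) * n) := by
        refine pow_le_pow_right₀ hX1 ?_
        have : 1 ≤ n := Nat.one_le_iff_ne_zero.2 hn
        nlinarith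
  refine h4.trans ?_
  have hlog : 0 ≤ Real.log X := Real.log_nonneg hX1
  rw [← Real.exp_log (pow_pos hX0 _), Real.log_pow, Real.exp_le_exp]
  have hε9 : (n : ℝ) ≤ 128 * ε ^ (-9 : ℤ) := by
    refine hn2.trans ?_
    rw [zpow_neg, div_eq_mul_inv]
    have : ε ^ (9 : ℤ) ≤ ε ^ 4 := by
      have : ε ^ (9 : ℤ) = ε ^ 9 := by norm_cast
      rw [this]
      exact pow_le_pow_of_le_one hε.le (by linarith) (by norm_num)
    gcongr
  push_cast
  calc (26 + (m : ℝ)) * n * Real.log X ≤ (26 + m) * (128 * ε ^ (-9 : ℤ)) * Real.log X := by gcongr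
    _ = _ := by ring

theorem theorem1 (σ : ℝ → ℝ) (hσ : UnivariateApproximator σ) :
    ∃ C : ℝ, 0 < C ∧
      ∀ (d : ℕ), 1 ≤ d → ∀ (ε : ℝ), 0 < ε →
        ∀ (f : EuclideanSpace ℝ (Fin d) → ℝ) (φ : ℝ → ℝ),
          (∀ x ∈ Metric.closedBall (0 : EuclideanSpace ℝ (Fin d)) 1, f x = φ ‖x‖) →
          LipschitzOnWith 1 f (Metric.closedBall (0 : EuclideanSpace ℝ (Fin d)) 1) →
          ∃ (w : ℕ) (v : Fin w → ℝ) (W : Fin w → EuclideanSpace ℝ (Fin d))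
            (b : Fin w → ℝ) (b₀ : ℝ),
            (w : ℝ) ≤ Real.exp (C * (ε ^ (-9 : ℤ) * Real.log ((d : ℝ) / ε))) ∧
            ∀ x ∈ Metric.closedBall (0 : EuclideanSpace ℝ (Fin d)) 1,
              |depthTwoNetwork σ v W b b₀ x - f x| ≤ ε := by
  obtain ⟨c, hc1, hc⟩ := hσ
  obtain ⟨m, hm⟩ := pow_unbounded_of_one_lt (16 * c) (one_lt_two (α := ℝ))
  refine ⟨128 * (26 + m), by positivity, ?_⟩
  intro d hd ε hε f φ hf hlip
  have hφ : ∀ r ∈ Set.Icc (0 : ℝ) 1, ∀ s ∈ Set.Icc (0 : ℝ) 1, |φ r - φ s| ≤ |r - s| :=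
    fun r hr s hs => abs_profile_sub_le hd hf hlip hr hs
  have hball : ∀ x ∈ Metric.closedBall (0 : EuclideanSpace ℝ (Fin d)) 1,
      ‖x‖ ∈ Set.Icc (0 : ℝ) 1 := fun x hx => ⟨norm_nonneg x, mem_closedBall_zero_iff.1 hx⟩
  -- For `ε ≥ 1/2` the constant `φ (1 / 2)` suffices with width 0, so a possibly negative logarithm
  -- does no harm.
  rcases le_or_gt (1 / 2) ε with hε2 | hε2
  · refine ⟨0, Fin.elim0, Fin.elim0, Fin.elim0, φ (1 / 2), by simpa using (Real.exp_pos _).le, ?_⟩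
    intro x hx
    rw [hf x hx]
    have hx' := hball x hx
    have h1 := hφ (1 / 2) ⟨by norm_num, by norm_num⟩ _ hx'
    have h2 : |1 / 2 - ‖x‖| ≤ 1 / 2 := by
      rw [abs_le]; constructor <;> linarith [hx'.1, hx'.2]
    simpa [depthTwoNetwork] using h1.trans (h2.trans hε2)
  have hd' : (1 : ℝ) ≤ d := by exact_mod_cast hd
  -- Error budget: `ε / 4` for the neurons, `t + ε / 4` for Bernstein, `t` for the surrogate.
  set t : ℝ := ε / 4 with ht
  have ht0 : 0 < t := by positivity
  have ht1 : t ≤ 1 := by rw [ht]; linarith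
  have h64 : 64 ≤ 64 / ε ^ 4 := by
    rw [le_div_iff₀ (by positivity)]
    have : ε ^ 4 ≤ 1 := pow_le_one₀ hε.le (by linarith)
    linarith
  -- The lower bound is exactly what gives `1 / (4 * n * t ^ 3) ≤ ε / 4`.
  obtain ⟨n, hn1, hn2⟩ : ∃ n : ℕ, 64 / ε ^ 4 ≤ n ∧ (n : ℝ) ≤ 128 / ε ^ 4 := by
    refine ⟨⌈64 / ε ^ 4⌉₊, Nat.le_ceil _, ?_⟩
    have h1 := (Nat.ceil_lt_add_one (by positivity : 0 ≤ 64 / ε ^ 4)).le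
    have h2 : 128 / ε ^ 4 = 64 / ε ^ 4 + 64 / ε ^ 4 := by ring
    linarith
  have hn0' : (0 : ℝ) < n := by linarith
  have hn0 : n ≠ 0 := by
    rintro rfl
    simp at hn0'
  -- Subtracting `φ 0` bounds the Bernstein coefficients by 1; the output bias restores it.
  let h : ℝ → ℝ := fun s => φ (√s) - φ 0
  have hsq : ∀ s ∈ Set.Icc (0 : ℝ) 1, √s ∈ Set.Icc (0 : ℝ) 1 := fun s hs =>
    ⟨Real.sqrt_nonneg s, Real.sqrt_le_one.2 hs.2⟩
  have hh : ∀ s ∈ Set.Icc (0 : ℝ) 1, ∀ t ∈ Set.Icc (0 : ℝ) 1, |h s - h t| ≤ √|s - t| := by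
    intro s hs t ht
    simp only [h, sub_sub_sub_cancel_right]
    exact (hφ _ (hsq s hs) _ (hsq t ht)).trans (abs_sqrt_sub_sqrt_le s t hs.1 ht.1)
  have hh1 : ∀ k : Fin (n + 1), |h (k / n)| ≤ 1 := by
    intro k
    have hk : ((k : ℕ) / n : ℝ) ∈ Set.Icc (0 : ℝ) 1 := (bernstein.z k).2
    have h1 := hφ _ (hsq _ hk) 0 ⟨le_rfl, zero_le_one⟩
    rw [sub_zero, abs_of_nonneg (hsq _ hk).1] at h1
    exact h1.trans (hsq _ hk).2
  set B : ℝ := 64 * d / ε ^ 2 with hB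
  have hBt : B = 4 * d / t ^ 2 := by rw [hB, ht]; field_simp; norm_num
  have hBt2 : 1 ≤ 2 * (d : ℝ) / t ^ 2 := by
    rw [le_div_iff₀ (by positivity)]
    have : t ^ 2 ≤ 1 := pow_le_one₀ ht0.le ht1
    linarith
  have hB1 : 1 ≤ B := by
    rw [hBt]
    have : 4 * (d : ℝ) / t ^ 2 = 2 * (2 * d / t ^ 2) := by ring
    linarith
  have hq : IsCosineSum B 1 (fun x : EuclideanSpace ℝ (Fin d) => trigNormSq t x) := by
    have := isCosineSum_const_add_trigNormSq hd ht0 ht1 0 1 (by simp)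
      (by rw [zero_add, one_mul, abs_of_nonneg (by linarith)])
    rw [hBt]
    simpa using this
  have hq' : IsCosineSum B 1 (fun x : EuclideanSpace ℝ (Fin d) => 1 - trigNormSq t x) := by
    have := isCosineSum_const_add_trigNormSq hd ht0 ht1 1 (-1) (by simp)
      (by rw [abs_le]; constructor <;> linarith)
    rw [hBt]
    simpa [sub_eq_add_neg] using this
  have hcos := IsCosineSum.bernstein_comp hB1 hq hq' n (fun k => h (k / n)) hh1
  rw [mul_one] at hcos
  have hM : 0 < (16 * B) ^ n := by positivity
  obtain ⟨w, v, W, b, b₀, hw, happ⟩ := hcos.exists_network (by linarith) hc hn0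
    (δ := ε / (4 * (16 * B) ^ n)) (by positivity)
  refine ⟨w, v, W, b, b₀ + φ 0,
    hw.trans (width_bound hm.le (by linarith) hd' hε hε2 hn0 hn2), ?_⟩
  intro x hx
  have hx' := hball x hx
  have hqx : trigNormSq t x ∈ Set.Icc (0 : ℝ) 1 :=
    ⟨trigNormSq_nonneg t x, (trigNormSq_le ht0 x).trans (pow_le_one₀ hx'.1 hx'.2)⟩
  have e1 := happ x hx
  have e2 := abs_bernstein_sub_le hh hn0 ht0 hqx
  have e3 := hh _ hqx (‖x‖ ^ 2) ⟨sq_nonneg _, pow_le_one₀ hx'.1 hx'.2⟩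
  have e1' : (16 * B) ^ n * (ε / (4 * (16 * B) ^ n)) = ε / 4 := by field_simp
  have e2' : 1 / (4 * n * t ^ 3) ≤ ε / 4 := by
    rw [div_le_iff₀ (by positivity)]
    rw [div_le_iff₀ (by positivity)] at hn1
    have : ε / 4 * (4 * n * t ^ 3) = n * ε ^ 4 / 64 := by rw [ht]; ring
    rw [this]; linarith
  have e3' : √|trigNormSq t x - ‖x‖ ^ 2| ≤ t := by
    rw [Real.sqrt_le_left ht0.le, abs_sub_comm,
      abs_of_nonneg (sub_nonneg.2 (trigNormSq_le ht0 x))]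
    exact norm_sq_sub_trigNormSq_le ht0 ht1 hx'.2
  have e4 : h (‖x‖ ^ 2) = f x - φ 0 := by
    simp only [h, Real.sqrt_sq hx'.1, hf x hx]
  have e5 : depthTwoNetwork σ v W b (b₀ + φ 0) x = depthTwoNetwork σ v W b b₀ x + φ 0 := by
    simp only [depthTwoNetwork, add_assoc]
  rw [e1'] at e1
  rw [e4] at e3
  rw [e5]
  rw [abs_le] at e1 e2 e3 ⊢
  constructor <;> linarith [e1.1, e1.2, e2.1, e2.2, e3.1, e3.2]
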